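/- Let $K$ be a field, $t\in K$, and work in the ring $K[[q]]$ of formal power series. For a permutation $\sigma\in\mathfrak S_n$ let $P(\sigma)$ be the shape of the binary search tree obtained by inserting the letters $\sigma_n,\sigma_{n-1},\dots,\sigma_1$ in this order. Let $(\mathbf F_\sigma)$ and $\mathbf G_\sigma=\mathbf F_{\sigma^{-1}}$ be the dual bases of the algebra $\mathbf{FQSym}$ of free quasi-symmetric functions, realized over a totally ordered alphabet $A$ by $\mathbf G_\sigma(A)=\sum_{\mathrm{std}(w)=\sigma}w$, and put $\mathbf P_T=\sum_{P(\sigma)=T}\mathbf F_\sigma$ for a binary tree $T$. Let $f(A)\mapsto f(A\cdot(1-t))$ be the adjoint, for the scalar product $(\mathbf F_\sigma,\mathbf G_\tau)=\delta_{\sigma,\tau}$, of the map $f(A)\mapsto f((1-t)A)=f*\sigma_1((1-t)A)$, where $\sigma_1((1-t)A)=\lambda_{-t}(A)\sigma_1(A)=\sum_{k,l}(-t)^k\Lambda_kS_l$ and $*$ is the internal product $\mathbf F_\sigma*\mathbf F_\tau=\mathbf F_{\sigma\circ\tau}$. Denote by $f(\mathbb X)$, $\mathbb X=\frac1{1-q}\,\hat\times\,(1-t)$,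 the value of $f(A\cdot(1-t))$ at the (commutative) alphabet $A=\frac1{1-q}=\{\cdots<q^2<q<1\}$. For a node $s$ of a binary tree $T$, let $n_s$ be the size of the subtree with root $s$ and $n'_s$ the size of the left subtree of $s$, and let $$h_s(t)=\frac1{1-q^{n_s}}\begin{cases}q^{n_s}-q^{n'_s}t&\text{if $s$ is the right son of its father,}\\ 1-q^{n'_s}t&\text{otherwise.}\end{cases}$$ **Theorem.** Let $T$ be a binary tree with $n$ nodes, and $(q)_n=\prod_{i=1}^n(1-q^i)$. Then $$\mathbf P_T(\mathbb X)=\prod_{s\in T}h_s(t).$$ Moreover $$(q)_n\,\mathbf P_T(\mathbb X)=\sum_{(\sigma,\epsilon)\,:\,P(\sigma)=T}(-t)^{m(\epsilon)}q^{\mathrm{maj}(\sigma,\epsilon)},$$ so that, replacing $t$ by $-t$, the generating function of the signed permutations of shape $T$ by major index and number of signs is $$\sum_{(\sigma,\epsilon)\,:\,P(\sigma)=T}t^{m(\epsilon)}q^{\mathrm{maj}(\sigma,\epsilon)}=(q)_n\,\mathbf P_T(\mathbb X)|_{t\to-t}=(q)_n\prod_{s\in T}h_s(-t).$$ Here $(\sigma,\epsilon)$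 runs over $\mathfrak S_n\times\{\pm1\}^n$, $m(\epsilon)$ is the number of entries $-1$ of $\epsilon$, and $\mathrm{maj}(\sigma,\epsilon)$ is the sum of the $i\in\{1,\dots,n-1\}$ with $\epsilon_i\sigma_i>\epsilon_{i+1}\sigma_{i+1}$. Furthermore, $h_s$ is the contribution of the label of $s$ among these signed permutations: label the nodes of $T$ by $1,\dots,n$ so that $T$ is a binary search tree, and let $\ell(s)$ be the label of $s$. Then for all $u_1,\dots,u_n\in K$, $$\sum_{(\sigma,\epsilon)\,:\,P(\sigma)=T}\Big(\prod_{i\,:\,\epsilon_i=-1}(-u_{\sigma_i})\Big)q^{\mathrm{maj}(\sigma,\epsilon)}=(q)_n\prod_{s\in T}h_s(u_{\ell(s)}).$$ -/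

import Mathlib

noncomputable section

namespace HookTree

open PowerSeries Finset

/-! ### Free quasi-symmetric functions -/

/-- The homogeneous component of degree `n` of `FQSym` over `K`, as the space of formal
combinations of the basis elements `F_σ`, `σ ∈ 𝔖_n`. The ring multiplication of the group algebra
is the internal product of `FQSym`: `F_σ * F_τ = F_{σ ∘ τ}`. -/
abbrev FQSym (K : Type*) [Field K] (n : ℕ) := MonoidAlgebra K (Equiv.Perm (Fin n))

/-- The basis element `F_σ`. -/
def F (K : Type*) [Field K] {n : ℕ} (σ : Equiv.Perm (Fin n)) : FQSym K n :=
  MonoidAlgebra.single σ 1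

/-- The basis element `G_σ = F_{σ⁻¹}`. -/
def G (K : Type*) [Field K] {n : ℕ} (σ : Equiv.Perm (Fin n)) : FQSym K n := F K σ⁻¹

/-- The coefficient of `G_σ` in `x`. -/
def gCoeff {K : Type*} [Field K] {n : ℕ} (x : FQSym K n) (σ : Equiv.Perm (Fin n)) : K :=
  x.coeff σ⁻¹

/-- The standardization of a word `w = w_1 ⋯ w_n` over a totally ordered alphabet: number the
letters from the smallest to the largest one, equal letters from left to right.
(`Tuple.sort w` lists the positions in that order, hence the inverse.) -/
def std {α : Type*} [LinearOrder α] {n : ℕ} (w : Fin n → α) : Equiv.Perm (Fin n) :=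
  (Tuple.sort w)⁻¹

/-- The (outer) product of `FQSym`: `G_α G_β = ∑ G_γ` over the permutations `γ = u · v` with
`std u = α` and `std v = β`, extended bilinearly. -/
def outer {K : Type*} [Field K] {k l n : ℕ} (h : k + l = n) (x : FQSym K k) (y : FQSym K l) :
    FQSym K n :=
  ∑ γ : Equiv.Perm (Fin n),
    (gCoeff x (std fun i : Fin k => γ (Fin.cast h (Fin.castAdd l i))) *
      gCoeff y (std fun j : Fin l => γ (Fin.cast h (Fin.natAdd k j)))) • G K γ

/-- The noncommutative complete function `S_n = G_{12⋯n}`. -/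
def completeS (K : Type*) [Field K] (n : ℕ) : FQSym K n := G K 1

/-- The noncommutative elementary function `Λ_n = G_{n⋯21}`. -/
def elemLambda (K : Type*) [Field K] (n : ℕ) : FQSym K n := G K Fin.revPerm

/-- `S_n((1-t)A)`, the component of degree `n` of `σ_1((1-t)A) = λ_{-t}(A) σ_1(A)`. -/
def completeOneSub {K : Type*} [Field K] (t : K) (n : ℕ) : FQSym K n :=
  ∑ p ∈ (antidiagonal n).attach,
    (-t) ^ p.1.1 • outer (mem_antidiagonal.1 p.2) (elemLambda K p.1.1) (completeS K p.1.2)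

/-- The transformation `f(A) ↦ f((1-t)A) = f(A) * σ_1((1-t)A)` (internal product). -/
def oneSubMul {K : Type*} [Field K] (t : K) {n : ℕ} (x : FQSym K n) : FQSym K n :=
  x * completeOneSub t n

/-- The scalar product of `FQSym`: `(G_σ, G_τ) = δ_{σ, τ⁻¹}`, so that `F` and `G` are dual
bases. -/
def pairing {K : Type*} [Field K] {n : ℕ} (x y : FQSym K n) : K :=
  ∑ σ : Equiv.Perm (Fin n), x.coeff σ * y.coeff σ⁻¹

/-- The transformation `f(A) ↦ f(A·(1-t))`, adjoint to `f(A) ↦ f((1-t)A)`. -/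
def mulOneSub {K : Type*} [Field K] (t : K) {n : ℕ} (x : FQSym K n) : FQSym K n :=
  ∑ τ : Equiv.Perm (Fin n), pairing x (oneSubMul t (G K τ)) • F K τ

/-- `mulOneSub t` is the adjoint of `oneSubMul t`. -/
theorem pairing_mulOneSub {K : Type*} [Field K] (t : K) {n : ℕ} (x y : FQSym K n) :
    pairing (mulOneSub t x) y = pairing x (oneSubMul t y) := by
  have hy : y = ∑ τ : Equiv.Perm (Fin n), y.coeff τ⁻¹ • G K τ := by
    ext a
    simp only [G, F, MonoidAlgebra.coeff_sum, MonoidAlgebra.coeff_smul, Finsupp.finsetSum_apply,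
      Finsupp.smul_apply, MonoidAlgebra.coeff_single, Finsupp.single_apply, smul_eq_mul,
      mul_ite, mul_one, mul_zero]
    rw [Finset.sum_eq_single a⁻¹] <;> aesop
  have hx : ∀ σ : Equiv.Perm (Fin n),
      (mulOneSub t x).coeff σ = pairing x (oneSubMul t (G K σ)) := by
    intro σ
    simp [mulOneSub, F, MonoidAlgebra.coeff_sum, Finsupp.finsetSum_apply,
      Finsupp.single_apply]
  conv_rhs => rw [hy]
  unfold pairing at *
  simp only [hx]
  simp only [oneSubMul, Finset.sum_mul, MonoidAlgebra.coeff_sum, Finsupp.finsetSum_apply,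
    smul_mul_assoc, MonoidAlgebra.coeff_smul, Finsupp.smul_apply, smul_eq_mul, Finset.mul_sum]
  rw [Finset.sum_comm]
  refine Finset.sum_congr rfl fun a _ => Finset.sum_congr rfl fun b _ => by ring

/-- The specialization `A = 1/(1-q)` of `x ∈ FQSym_n`, as a formal power series in `q = X`.
In the realization `G_σ(A) = ∑_{std w = σ} w`, the letters are the powers of `q`, ordered by
`⋯ < q² < q < 1`; the letter `q^i` is encoded by its exponent `i`, whence the dual order on `ℕ`.
The coefficient of `q^d` is the sum, over the words `w` with exponents of sum `d`, of the
coefficient of `w` in `x(A)`. -/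
def specGeom {K : Type*} [Field K] {n : ℕ} (x : FQSym K n) : K⟦X⟧ :=
  PowerSeries.mk fun d =>
    ∑ w ∈ Finset.Nat.antidiagonalTuple n d, gCoeff x (std fun i => OrderDual.toDual (w i))

/-- The specialization of `x` at the alphabet `𝕏 = 1/(1-q) ×̂ (1-t)`: the value at `A = 1/(1-q)`
of `x(A·(1-t))`. -/
def specX {K : Type*} [Field K] (t : K) {n : ℕ} (x : FQSym K n) : K⟦X⟧ :=
  specGeom (mulOneSub t x)

/-! ### Binary search trees and the elements `P_T` -/

/-- Insertion of a letter in a binary search tree. -/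
def bstInsert {α : Type*} [LinearOrder α] (a : α) : BinaryTree α → BinaryTree α
  | .nil => .node a .nil .nil
  | .node b l r => if a ≤ b then .node b (bstInsert a l) r else .node b l (bstInsert a r)

/-- The shape `P(σ)` of the binary search tree of `σ`, obtained by inserting the letters
`σ_n, …, σ_1` in this order (so that the root is `σ_n`). -/
def bstShape {n : ℕ} (σ : Equiv.Perm (Fin n)) : BinaryTree Unit :=
  ((List.ofFn σ).foldr bstInsert .nil).map fun _ => ()

/-- `P_T = ∑_{P(σ) = T} F_σ`. -/
def P (K : Type*) [Field K] (T : BinaryTree Unit) : FQSym K T.numNodes :=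
  ∑ σ : Equiv.Perm (Fin T.numNodes) with bstShape σ = T, F K σ

/-! ### Nodes and hook-content factors -/

/-- The data of a node `s` of a binary tree: the size of the subtree with root `s`, the size of
the left subtree of `s`, whether `s` is the right son of its father, and the label of `s` in the
standard labelling (by `1, …, n`) that makes the tree a binary search tree. -/
structure NodeData where
  size : ℕ
  leftSize : ℕ
  isRightSon : Bool
  label : ℕ

/-- The nodes of a subtree whose labels start at `o + 1`; `b` tells whether the root of
the subtree is a right son. -/
def nodesAux : ℕ → Bool → BinaryTree Unit → List NodeData
  | _, _, .nil => []
  | o, b, .node _ l r =>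
    nodesAux o false l ++
      ⟨l.numNodes + r.numNodes + 1, l.numNodes, b, o + l.numNodes + 1⟩ ::
        nodesAux (o + l.numNodes + 1) true r

/-- The list of the nodes of a binary tree (the root is not a right son). -/
def nodes (T : BinaryTree Unit) : List NodeData := nodesAux 0 false T

/-- The `(q,t)`-hook-content factor of a node: `(q^n - q^{n'} t)/(1 - q^n)` for a right son and
`(1 - q^{n'} t)/(1 - q^n)` otherwise. -/
def hookContent {K : Type*} [Field K] (t : K) (s : NodeData) : K⟦X⟧ :=
  ((if s.isRightSon then X ^ s.size else 1) - X ^ s.leftSize * C t) * (1 - X ^ s.size)⁻¹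

/-! ### Signed permutations -/

/-- The signed word `(σ, ε)`, with letters `ε_i σ_i ∈ {±1, …, ±n}`. -/
def signedWord {n : ℕ} (σ : Equiv.Perm (Fin n)) (ε : Fin n → ℤˣ) (i : Fin n) : ℤ :=
  (ε i : ℤ) * ((σ i : ℕ) + 1)

/-- The major index: the sum of the positions `i ∈ {1, …, n-1}` with `w_i > w_{i+1}`. -/
def maj {n : ℕ} (w : Fin n → ℤ) : ℕ :=
  ∑ i : Fin n, if ∃ h : (i : ℕ) + 1 < n, w ⟨i + 1, h⟩ < w i then (i : ℕ) + 1 else 0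

/-- `m(ε)`, the number of entries `-1`. -/
def numNeg {n : ℕ} (ε : Fin n → ℤˣ) : ℕ := #{i : Fin n | ε i = -1}

/-- `(q)_n = (1-q)(1-q²)⋯(1-q^n)`. -/
def qPoch (K : Type*) [Field K] (n : ℕ) : K⟦X⟧ := ∏ i ∈ Finset.range n, (1 - X ^ (i + 1))

/-- `∑ t^{m(ε)} q^{maj(σ,ε)}` over the signed permutations `(σ, ε)` with `P(σ) = T`. -/
def signedGF {K : Type*} [Field K] (t : K) (T : BinaryTree Unit) : K⟦X⟧ :=
  ∑ σ : Equiv.Perm (Fin T.numNodes) with bstShape σ = T, ∑ ε : Fin T.numNodes → ℤˣ,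
    C t ^ numNeg ε * X ^ maj (signedWord σ ε)

/-- The refinement of `signedGF` in which each label has its own variable: a minus sign on the
letter `j` has weight `u j`. -/
def signedGFLabels {K : Type*} [Field K] (u : ℕ → K) (T : BinaryTree Unit) : K⟦X⟧ :=
  ∑ σ : Equiv.Perm (Fin T.numNodes) with bstShape σ = T, ∑ ε : Fin T.numNodes → ℤˣ,
    (∏ i : Fin T.numNodes with ε i = -1, C (u ((σ i : ℕ) + 1))) * X ^ maj (signedWord σ ε)

end HookTree

end

noncomputable section

namespace HookTree

open PowerSeries Finset

/-! ### Generating functions of weighted sets -/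

/-! Attach the signs to the labels instead of the positions, and fix them. Each label `x` then has a
signed value `signedLabel δ x`, and by the theory of P-partitions `q^maj / (q)_n` for `σ` counts the
functions `f` on the labels, by sum of values, whose sorting permutation is `σ`; one sorts by
decreasing `f`, ties being broken by the signed label (`qPoch_mul_weightGF_sort`). Summing over the
`σ` of shape `T` gives all `f` that are heap-ordered on `T`, the root having the largest key, hence
the least value (`bstShape_sort_eq_iff`).

Of two signed labels, the sign of the one with larger absolute value decides the order. A left
descendant therefore exceeds its ancestor strictly exactly when the ancestor is negative, and a
right subtree exceeds the father strictly exactly when its own root is positive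
(`heapOrdered_node_iff`). Removing these gaps makes the subtrees independent: `s` contributes
`1/(1-q^{n_s})`, times `q^{n'_s}` if it is negative, times `q^{n_s}` if it is a positive right son
(`weightGF_heapFilling`). The signs of distinct nodes being independent, summing over them gives `∏
h_s` (`signedGFLabels_eq`).

On the algebraic side, `S_n((1-t)A)` is the sum over sign vectors of `(-t)^m G_γ`, where `γ` sorts
the signed labels (`gCoeff_completeOneSub_eq_sum_signs`). As `γ⁻¹σ` has the same descents as the
signed word and `F_τ` specializes to `q^{maj τ}/(q)_n`, `(q)_n P_T(𝕏)` is the same signed sum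
(`qPoch_mul_specX`). -/

/-- The generating function `∑ q^{wt a}` of a set with a weight function. -/
def weightGF (K : Type*) [Field K] {A : Type*} (wt : A → ℕ) : K⟦X⟧ :=
  PowerSeries.mk fun d => (Nat.card {a // wt a = d} : K)

section weightGF

variable {K : Type*} [Field K] {A B : Type*}

theorem weightGF_congr {wa : A → ℕ} {wb : B → ℕ} (e : A ≃ B) (h : ∀ a, wb (e a) = wa a) :
    weightGF K wa = weightGF K wb := by
  ext d
  simp only [weightGF, coeff_mk]
  congr 1
  exact Nat.card_congr (e.subtypeEquiv fun a => by rw [h])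

theorem weightGF_unique [Unique A] {wt : A → ℕ} (h : wt default = 0) : weightGF K wt = 1 := by
  ext d
  rw [weightGF, coeff_mk, coeff_one]
  split_ifs with hd
  · have : Unique {a // wt a = d} :=
      ⟨⟨⟨default, h.trans hd.symm⟩⟩, fun a => Subtype.ext (Unique.eq_default _)⟩
    rw [Nat.card_unique, Nat.cast_one]
  · have : IsEmpty {a // wt a = d} :=
      ⟨fun a => hd (by rw [← a.2, Unique.eq_default a.1, h])⟩
    simp

theorem weightGF_add_const (wt : A → ℕ) (c : ℕ) :
    weightGF K (fun a => wt a + c) = X ^ c * weightGF K wt := by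
  ext d
  rw [coeff_X_pow_mul']
  simp only [weightGF, coeff_mk]
  split_ifs with h
  · congr 1
    exact Nat.card_congr (Equiv.subtypeEquivRight fun a => by omega)
  · have : IsEmpty {a // wt a + c = d} := ⟨fun a => by have := a.2; omega⟩
    simp

/-- Pairs of total weight `d`, sorted by the weights of their components. -/
def prodFiberEquiv (wa : A → ℕ) (wb : B → ℕ) (d : ℕ) :
    {p : A × B // wa p.1 + wb p.2 = d} ≃
      Σ x : antidiagonal d, {a // wa a = x.1.1} × {b // wb b = x.1.2} where
  toFun p := ⟨⟨(wa p.1.1, wb p.1.2), mem_antidiagonal.2 p.2⟩, ⟨p.1.1, rfl⟩, ⟨p.1.2, rfl⟩⟩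
  invFun x := ⟨(x.2.1.1, x.2.2.1), by
    rw [x.2.1.2, x.2.2.2]; exact mem_antidiagonal.1 x.1.2⟩
  left_inv p := rfl
  right_inv := by
    rintro ⟨⟨⟨i, j⟩, h⟩, ⟨a, ha⟩, ⟨b, hb⟩⟩
    change wa a = i at ha
    change wb b = j at hb
    subst ha hb
    rfl

/-- Finite fibres are needed because `Nat.card` of an infinite type is `0`, which breaks additivity
over the splittings of the weight. -/
theorem weightGF_prod (wa : A → ℕ) (wb : B → ℕ) (ha : ∀ d, Finite {a // wa a = d})
    (hb : ∀ d, Finite {b // wb b = d}) :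
    weightGF K (fun p : A × B => wa p.1 + wb p.2) = weightGF K wa * weightGF K wb := by
  ext d
  rw [coeff_mul]
  simp only [weightGF, coeff_mk]
  rw [Nat.card_congr (prodFiberEquiv wa wb d), Nat.card_sigma]
  simp only [Nat.card_prod, Nat.cast_sum, Nat.cast_mul]
  exact Finset.sum_coe_sort (antidiagonal d) fun x =>
    (Nat.card {a // wa a = x.1} : K) * (Nat.card {b // wb b = x.2} : K)

theorem finite_prod_fiber {wa : A → ℕ} {wb : B → ℕ} (ha : ∀ d, Finite {a // wa a = d})
    (hb : ∀ d, Finite {b // wb b = d}) (d : ℕ) :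
    Finite {p : A × B // wa p.1 + wb p.2 = d} :=
  Finite.of_equiv _ (prodFiberEquiv wa wb d).symm

theorem finite_mul_fiber {n : ℕ} (hn : 0 < n) (d : ℕ) : Finite {k : ℕ // n * k = d} := by
  have : Subsingleton {k : ℕ // n * k = d} :=
    ⟨fun a b => Subtype.ext (Nat.eq_of_mul_eq_mul_left hn (a.2.trans b.2.symm))⟩
  infer_instance

theorem constantCoeff_one_sub_X_pow {n : ℕ} (hn : 0 < n) :
    constantCoeff (1 - X ^ n : K⟦X⟧) ≠ 0 := by
  simp [hn.ne']

theorem weightGF_nat {n : ℕ} (hn : 0 < n) :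
    weightGF K (fun k : ℕ => n * k) = (1 - X ^ n)⁻¹ := by
  rw [PowerSeries.eq_inv_iff_mul_eq_one (constantCoeff_one_sub_X_pow hn)]
  have key : ∀ d, Nat.card {k : ℕ // n * k = d} = if n ∣ d then 1 else 0 := by
    intro d
    split_ifs with h
    · obtain ⟨k, rfl⟩ := h
      rw [Nat.card_eq_one_iff_unique]
      exact ⟨⟨fun a b => Subtype.ext (Nat.eq_of_mul_eq_mul_left hn (a.2.trans b.2.symm))⟩,
        ⟨⟨k, rfl⟩⟩⟩
    · have : IsEmpty {k : ℕ // n * k = d} := ⟨fun k => h ⟨k.1, k.2.symm⟩⟩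
      simp
  ext d
  rw [mul_sub, mul_one, map_sub, coeff_mul_X_pow', coeff_one]
  simp only [weightGF, coeff_mk, key]
  rcases Nat.eq_zero_or_pos d with rfl | hd
  · simp [hn.ne']
  · rw [if_neg hd.ne']
    by_cases hnd : n ≤ d
    · have : n ∣ d - n ↔ n ∣ d := by
        rw [Nat.dvd_sub_iff_left hnd (dvd_refl n)]
      simp [hnd, this]
    · have : ¬ n ∣ d := fun h => hnd (Nat.le_of_dvd hd h)
      simp [hnd, this]

theorem sum_weightGF_fiber {ι : Type*} [Fintype ι] (wt : A → ℕ)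
    (hA : ∀ d, Finite {a // wt a = d}) (g : A → ι) (p : ι → Prop) [DecidablePred p] :
    ∑ i with p i, weightGF K (fun a : {a // g a = i} => wt a) =
      weightGF K (fun a : {a // p (g a)} => wt a) := by
  classical
  ext d
  rw [map_sum]
  simp only [weightGF, coeff_mk]
  rw [← Nat.cast_sum]
  congr 1
  have := hA d
  have := Fintype.ofFinite {a // wt a = d}
  have h1 : ∀ i, Nat.card {a : {a // g a = i} // wt a = d} =
      #{a : {a // wt a = d} | g a = i} := by
    intro i
    rw [← Fintype.card_subtype, ← Nat.card_eq_fintype_card]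
    exact Nat.card_congr (Equiv.subtypeSubtypeEquivSubtypeInter _ _ |>.trans
      ((Equiv.subtypeEquivRight fun a => and_comm).trans
        (Equiv.subtypeSubtypeEquivSubtypeInter (fun a => wt a = d) (fun a => g a = i)).symm))
  have h2 : Nat.card {a : {a // p (g a)} // wt a = d} = #{a : {a // wt a = d} | p (g a)} := by
    rw [← Fintype.card_subtype, ← Nat.card_eq_fintype_card]
    exact Nat.card_congr (Equiv.subtypeSubtypeEquivSubtypeInter _ _ |>.trans
      ((Equiv.subtypeEquivRight fun a => and_comm).trans
        (Equiv.subtypeSubtypeEquivSubtypeInter (fun a => wt a = d) (fun a => p (g a))).symm))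
  rw [h2, Finset.sum_congr rfl fun i _ => h1 i]
  rw [Finset.card_eq_sum_card_fiberwise (f := fun a : {a // wt a = d} => g a)
    (t := {i | p i}) (fun a ha => by simpa using ha)]
  refine Finset.sum_congr rfl fun i hi => ?_
  congr 1
  ext a
  simp only [mem_filter, mem_univ, true_and] at hi ⊢
  constructor
  · rintro rfl; exact ⟨hi, rfl⟩
  · exact fun h => h.2

theorem finite_sum_fiber {ι : Type*} [Fintype ι] (d : ℕ) :
    Finite {f : ι → ℕ // ∑ i, f i = d} := by
  classical
  refine Finite.of_injective (β := ι → Fin (d + 1))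
    (fun f i => ⟨f.1 i, Nat.lt_succ_of_le ((Finset.single_le_sum (fun _ _ => Nat.zero_le _)
      (mem_univ i)).trans_eq f.2)⟩) ?_
  intro f g h
  ext i
  simpa using congrArg Fin.val (congrFun h i)

theorem finite_subtype_fiber {wt : A → ℕ} (hA : ∀ d, Finite {a // wt a = d}) (p : A → Prop)
    (d : ℕ) : Finite {a : {a // p a} // wt a = d} := by
  have := hA d
  exact Finite.of_injective (β := {a // wt a = d}) (fun a => ⟨a.1.1, a.2⟩)
    (fun a b h => Subtype.ext (Subtype.ext (Subtype.mk.inj h)))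

end weightGF

/-! ### Decreasing sequences and sorting permutations -/

/-- The sequences `g_0, …, g_{n-1}` with `g_i - g_{i+1} ≥ s_i`. -/
def GapDecreasing (s : ℕ → ℕ) {n : ℕ} (g : Fin n → ℕ) : Prop :=
  ∀ i (h : i + 1 < n), g ⟨i + 1, h⟩ + s i ≤ g ⟨i, by omega⟩

theorem GapDecreasing.antitone {s : ℕ → ℕ} {n : ℕ} {g : Fin n → ℕ} (hg : GapDecreasing s g) :
    Antitone g := by
  cases n with
  | zero => exact fun i => i.elim0
  | succ n =>
    rw [Fin.antitone_iff_succ_le]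
    intro i
    have := hg i (by omega)
    exact (Nat.le_add_right _ _).trans this

/-- A sequence of length `n + 1` is given by its last entry and the shifted initial segment. -/
def extendGap (s : ℕ → ℕ) (n : ℕ) (x : ℕ × {g : Fin n → ℕ // GapDecreasing s g}) :
    {g : Fin (n + 1) → ℕ // GapDecreasing s g} :=
  -- `s (n - 1)` is the gap just before the new last entry. For `n = 0` the initial segment is
  -- empty, so the truncated index is harmless.
  ⟨Fin.snoc (fun i => x.2.1 i + (x.1 + s (n - 1))) x.1, by
    intro i h
    rcases Nat.lt_or_ge (i + 1) n with h1 | h1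
    · have e1 : (⟨i + 1, h⟩ : Fin (n + 1)) = Fin.castSucc ⟨i + 1, h1⟩ := rfl
      have e2 : (⟨i, by omega⟩ : Fin (n + 1)) = Fin.castSucc ⟨i, by omega⟩ := rfl
      rw [e1, e2, Fin.snoc_castSucc, Fin.snoc_castSucc]
      have := x.2.2 i h1
      omega
    · obtain rfl : n = i + 1 := by omega
      have e1 : (⟨i + 1, h⟩ : Fin (i + 1 + 1)) = Fin.last (i + 1) := rfl
      have e2 : (⟨i, by omega⟩ : Fin (i + 1 + 1)) = Fin.castSucc (Fin.last i) := rfl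
      rw [e1, e2, Fin.snoc_castSucc, Fin.snoc_last]
      simp only [Nat.add_sub_cancel]
      omega⟩

theorem extendGap_bijective (s : ℕ → ℕ) (n : ℕ) : Function.Bijective (extendGap s n) := by
  constructor
  · rintro ⟨m, g, hg⟩ ⟨m', g', hg'⟩ h
    have h' := Subtype.mk.inj h
    have h1 : m = m' := by simpa using congrFun h' (Fin.last n)
    subst h1
    have h2 : g = g' := by
      funext i
      simpa using congrFun h' i.castSucc
    subst h2
    rfl
  · rintro ⟨g, hg⟩
    -- The last entry of the initial segment is its least one, so this bound holds for all of them
    -- and the subtractions below do not truncate.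
    have hle : ∀ i : Fin n, g (Fin.last n) + s (n - 1) ≤ g i.castSucc := by
      intro i
      obtain ⟨k, rfl⟩ : ∃ k, n = k + 1 := ⟨n - 1, by have := i.2; omega⟩
      refine (hg k (by omega)).trans (hg.antitone ?_)
      exact Fin.castSucc_le_castSucc_iff.2 (Fin.le_last i)
    refine ⟨⟨g (Fin.last n), fun i => g i.castSucc - (g (Fin.last n) + s (n - 1)), ?_⟩, ?_⟩
    · intro i h
      have h1 := hle ⟨i, by omega⟩
      have h2 := hle ⟨i + 1, h⟩
      have h3 := hg i (by omega)
      simp only [Fin.castSucc_mk] at *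
      omega
    · apply Subtype.ext
      funext i
      refine Fin.lastCases ?_ (fun i => ?_) i
      · simp [extendGap]
      · have := hle i
        simp only [extendGap, Fin.snoc_castSucc]
        omega

/-- Without gaps these are partitions into at most `n` parts, counted by `1/(q)_n`; a gap `s i`
raises the `i + 1` entries before it. The induction peels off the last entry, whose value is added
to all `n + 1` entries. -/
theorem qPoch_mul_weightGF_gapDecreasing (K : Type*) [Field K] (s : ℕ → ℕ) (n : ℕ) :
    qPoch K n * weightGF K (fun g : {g : Fin n → ℕ // GapDecreasing s g} => ∑ i, g.1 i) =
      X ^ ∑ i ∈ range (n - 1), (i + 1) * s i := by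
  induction n with
  | zero =>
    have : Unique {g : Fin 0 → ℕ // GapDecreasing s g} :=
      ⟨⟨⟨Fin.elim0, fun i h => absurd h (by omega)⟩⟩,
        fun a => Subtype.ext (Subsingleton.elim _ _)⟩
    rw [weightGF_unique (by simp)]
    simp [qPoch]
  | succ n ih =>
    have hfin := finite_subtype_fiber (finite_sum_fiber (ι := Fin n)) (GapDecreasing s)
    have h1 : weightGF K (fun g : {g : Fin (n + 1) → ℕ // GapDecreasing s g} => ∑ i, g.1 i) =
        X ^ (n * s (n - 1)) * ((1 - X ^ (n + 1))⁻¹ *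
          weightGF K (fun g : {g : Fin n → ℕ // GapDecreasing s g} => ∑ i, g.1 i)) := by
      rw [← weightGF_nat n.succ_pos, ← weightGF_prod _ _ (finite_mul_fiber n.succ_pos) hfin,
        ← weightGF_add_const]
      refine (weightGF_congr (Equiv.ofBijective _ (extendGap_bijective s n)) ?_).symm
      rintro ⟨m, g, hg⟩
      simp [extendGap, Fin.sum_univ_castSucc, sum_add_distrib]
      ring
    have h2 : (1 - X ^ (n + 1) : K⟦X⟧) * (1 - X ^ (n + 1))⁻¹ = 1 :=
      PowerSeries.mul_inv_cancel _ (constantCoeff_one_sub_X_pow n.succ_pos)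
    have h3 : ∑ i ∈ range (n + 1 - 1), (i + 1) * s i =
        n * s (n - 1) + ∑ i ∈ range (n - 1), (i + 1) * s i := by
      cases n with
      | zero => simp
      | succ n => simp [sum_range_succ, add_comm]
    rw [h1, h3, pow_add X (n * s (n - 1)), ← ih, qPoch, prod_range_succ, ← qPoch]
    linear_combination (qPoch K n * X ^ (n * s (n - 1)) *
      weightGF K (fun g : {g : Fin n → ℕ // GapDecreasing s g} => ∑ i, g.1 i)) * h2

/-- Sorting by this key means sorting by decreasing `f`, ties being broken by increasing `ω`. -/
def sortKey {α : Type*} (f : α → ℕ) (ω : α → ℤ) (j : α) : ℕᵒᵈ ×ₗ ℤ :=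
  toLex (OrderDual.toDual (f j), ω j)

theorem sortKey_lt {α : Type*} {f : α → ℕ} {ω : α → ℤ} {i j : α} :
    sortKey f ω i < sortKey f ω j ↔ f j < f i ∨ f i = f j ∧ ω i < ω j := by
  simp [sortKey, Prod.Lex.toLex_lt_toLex]

theorem sortKey_le {α : Type*} {f : α → ℕ} {ω : α → ℤ} {i j : α} :
    sortKey f ω i ≤ sortKey f ω j ↔ f j < f i ∨ f i = f j ∧ ω i ≤ ω j := by
  simp [sortKey, Prod.Lex.toLex_le_toLex]

theorem sortKey_injective {α : Type*} {f : α → ℕ} {ω : α → ℤ} (hω : Function.Injective ω) :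
    Function.Injective (sortKey f ω) := by
  intro i j h
  exact hω (congrArg (fun x => (ofLex x).2) h)

theorem sort_eq_iff_of_injective {α : Type*} [LinearOrder α] {n : ℕ} {f : Fin n → α}
    (hf : Function.Injective f) {σ : Equiv.Perm (Fin n)} :
    Tuple.sort f = σ ↔ Monotone (f ∘ σ) := by
  rw [eq_comm, Tuple.eq_sort_iff]
  refine and_iff_left_of_imp fun _ i j hij h => ?_
  exact absurd (σ.injective (hf h)) hij.ne

/-- The indicator of the descents of a word. -/
def descentIndicator {n : ℕ} (w : Fin n → ℤ) (i : ℕ) : ℕ :=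
  if ∃ h : i + 1 < n, w ⟨i + 1, h⟩ < w ⟨i, by omega⟩ then 1 else 0

theorem maj_eq_sum_range {n : ℕ} (w : Fin n → ℤ) :
    maj w = ∑ i ∈ range (n - 1), (i + 1) * descentIndicator w i := by
  have h : maj w = ∑ i ∈ range n, (i + 1) * descentIndicator w i := by
    rw [maj, ← Fin.sum_univ_eq_sum_range (fun i => (i + 1) * descentIndicator w i) n]
    refine sum_congr rfl fun i _ => ?_
    simp [descentIndicator]
  rw [h]
  cases n with
  | zero => rfl
  | succ n => simp [sum_range_succ, descentIndicator]

/-- A tie between neighbours is allowed only where `ω ∘ σ` ascends, so each descent forces a strict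
decrease. -/
theorem monotone_sortKey_iff {n : ℕ} {f : Fin n → ℕ} {ω : Fin n → ℤ}
    {σ : Equiv.Perm (Fin n)} :
    Monotone (sortKey f ω ∘ σ) ↔ GapDecreasing (descentIndicator (ω ∘ σ)) (f ∘ σ) := by
  have h1 : Monotone (sortKey f ω ∘ σ) ↔ ∀ i (h : i + 1 < n),
      sortKey f ω (σ ⟨i, by omega⟩) ≤ sortKey f ω (σ ⟨i + 1, h⟩) := by
    cases n with
    | zero => exact ⟨fun _ i h => absurd h (by omega), fun _ i => i.elim0⟩
    | succ n =>
      rw [Fin.monotone_iff_le_succ]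
      exact ⟨fun H i h => H ⟨i, by omega⟩, fun H i => H i (by omega)⟩
  rw [h1]
  refine forall_congr' fun i => forall_congr' fun h => ?_
  rw [sortKey_le]
  simp only [descentIndicator, Function.comp_apply, h, exists_true_left]
  split_ifs with h2 <;> constructor <;> intro h3 <;> grind

theorem qPoch_mul_weightGF_sort (K : Type*) [Field K] {n : ℕ} {ω : Fin n → ℤ}
    (hω : Function.Injective ω) (σ : Equiv.Perm (Fin n)) :
    qPoch K n * weightGF K
      (fun f : {f : Fin n → ℕ // Tuple.sort (sortKey f ω) = σ} => ∑ i, f.1 i) =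
      X ^ maj (ω ∘ σ) := by
  rw [maj_eq_sum_range, ← qPoch_mul_weightGF_gapDecreasing]
  congr 1
  refine weightGF_congr ((σ.symm.arrowCongr (Equiv.refl ℕ)).subtypeEquiv fun f => ?_) ?_
  · rw [sort_eq_iff_of_injective (sortKey_injective hω), monotone_sortKey_iff]
    rfl
  · rintro ⟨f, hf⟩
    exact Equiv.sum_comp σ f

/-! ### Binary search trees of sorted words -/

/-- A root never changes and sends each letter to one side, so the two subtrees grow independently
from complementary subwords. -/
theorem foldr_bstInsert_node {α : Type*} [LinearOrder α] (a : α) (l r : BinaryTree α)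
    (w : List α) :
    w.foldr bstInsert (.node a l r) =
      .node a ((w.filter (· ≤ a)).foldr bstInsert l) ((w.filter (a < ·)).foldr bstInsert r) := by
  induction w with
  | nil => rfl
  | cons b w ih =>
    by_cases h : b ≤ a
    · simp [ih, bstInsert, h, not_lt.2 h]
    · simp [ih, bstInsert, h, not_le.1 h]

theorem map_bstInsert {α β : Type*} [LinearOrder α] [LinearOrder β] {φ : α → β}
    (hφ : StrictMono φ) (a : α) (T : BinaryTree α) :
    (bstInsert a T).map φ = bstInsert (φ a) (T.map φ) := by
  induction T with
  | nil => rfl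
  | node b l r ihl ihr =>
    by_cases h : a ≤ b
    · simp [bstInsert, BinaryTree.map, h, hφ.le_iff_le, ihl]
    · simp [bstInsert, BinaryTree.map, h, hφ.le_iff_le, ihr]

theorem map_foldr_bstInsert {α β : Type*} [LinearOrder α] [LinearOrder β] {φ : α → β}
    (hφ : StrictMono φ) (w : List α) :
    (w.foldr bstInsert .nil).map φ = (w.map φ).foldr bstInsert .nil := by
  induction w with
  | nil => rfl
  | cons b w ih => simp [map_bstInsert hφ, ih]

/-- The shape of the binary search tree of a word. -/
def listShape {α : Type*} [LinearOrder α] (w : List α) : BinaryTree Unit :=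
  (w.foldr bstInsert .nil).map fun _ => ()

theorem listShape_concat {α : Type*} [LinearOrder α] (w : List α) (a : α) :
    listShape (w ++ [a]) =
      .node () (listShape (w.filter (· ≤ a))) (listShape (w.filter (a < ·))) := by
  simp only [listShape, List.foldr_append, List.foldr_cons, List.foldr_nil, bstInsert,
    foldr_bstInsert_node, BinaryTree.map]

theorem bstShape_eq_listShape {n : ℕ} (σ : Equiv.Perm (Fin n)) :
    bstShape σ = listShape (List.ofFn fun i => (σ i : ℕ)) := by
  have h : (List.ofFn fun i => (σ i : ℕ)) = (List.ofFn σ).map Fin.val := by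
    rw [List.map_ofFn]; rfl
  rw [bstShape, listShape, h, ← map_foldr_bstInsert Fin.val_strictMono, ← BinaryTree.comp_map]

/-- Number the nodes of `T` in infix order, starting with `o`. The tree is heap-ordered with
respect to `key` if in every subtree the root has the largest key. -/
def HeapOrdered {κ : Type*} [LinearOrder κ] (key : ℕ → κ) : ℕ → BinaryTree Unit → Prop
  | _, .nil => True
  | o, .node _ l r =>
    (∀ j, o ≤ j → j < o + l.numNodes → key j < key (o + l.numNodes)) ∧
      (∀ j, o + l.numNodes + 1 ≤ j → j < o + l.numNodes + 1 + r.numNodes →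
        key j < key (o + l.numNodes)) ∧
      HeapOrdered key o l ∧ HeapOrdered key (o + l.numNodes + 1) r

/-- The last letter of a word sorted by key is the root and has the largest key. The labels to its
left and right are again intervals, listed in sorted subwords, so induction applies. -/
theorem listShape_eq_iff {κ : Type*} [LinearOrder κ] (key : ℕ → κ) (T : BinaryTree Unit) :
    ∀ (o n : ℕ) (w : List ℕ), w.Pairwise (fun i j => key i < key j) →
      (∀ j, j ∈ w ↔ o ≤ j ∧ j < o + n) →
      (listShape w = T ↔ T.numNodes = n ∧ HeapOrdered key o T) := by
  induction T with
  | nil =>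
    intro o n w _ hmem
    rcases List.eq_nil_or_concat' w with rfl | ⟨w, a, rfl⟩
    · have : n = 0 := by
        by_contra h
        exact List.not_mem_nil ((hmem o).2 ⟨le_rfl, by omega⟩)
      simp [listShape, BinaryTree.map, HeapOrdered, BinaryTree.numNodes, this]
    · have : n ≠ 0 := by
        have := (hmem a).1 (by simp)
        omega
      simp [listShape_concat, BinaryTree.numNodes, this.symm]
  | node u l r ihl ihr =>
    intro o n w hw hmem
    rcases List.eq_nil_or_concat' w with rfl | ⟨w, a, rfl⟩
    · have : n = 0 := by
        by_contra h
        exact List.not_mem_nil ((hmem o).2 ⟨le_rfl, by omega⟩)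
      simp [listShape, BinaryTree.map, BinaryTree.numNodes, this]
    · obtain ⟨hw1, -, hw2⟩ := List.pairwise_append.1 hw
      have hlt : ∀ j ∈ w, key j < key a := fun j hj => hw2 j hj a (by simp)
      have ha := (hmem a).1 (by simp)
      have hmem' : ∀ j, j ∈ w ↔ (o ≤ j ∧ j < o + n) ∧ j ≠ a := by
        intro j
        rw [← hmem j]
        constructor
        · exact fun h => ⟨by simp [h], fun e => (hlt j h).ne (by rw [e])⟩
        · rintro ⟨h, hne⟩
          simpa [hne] using h
      have hl := ihl o (a - o) (w.filter (· ≤ a)) (hw1.filter _) (by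
        intro j
        simp only [List.mem_filter, hmem', decide_eq_true_eq]
        omega)
      have hr := ihr (a + 1) (o + n - (a + 1)) (w.filter (a < ·)) (hw1.filter _) (by
        intro j
        simp only [List.mem_filter, hmem', decide_eq_true_eq]
        omega)
      rw [listShape_concat, BinaryTree.node.injEq, hl, hr]
      simp only [BinaryTree.numNodes, HeapOrdered]
      constructor
      · rintro ⟨-, ⟨h1, h2⟩, h3, h4⟩
        obtain rfl : a = o + l.numNodes := by omega
        exact ⟨by omega, fun j h5 h6 => hlt j ((hmem' j).2 (by omega)),
          fun j h5 h6 => hlt j ((hmem' j).2 (by omega)), h2, h4⟩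
      · rintro ⟨h1, h2, h3, h4, h5⟩
        -- Both `a` and the infix position of the root would have the largest key: the former by
        -- sorting, the latter by heap order.
        have : a = o + l.numNodes := by
          by_contra hne
          have h6 := hlt (o + l.numNodes) ((hmem' _).2 ⟨by omega, fun e => hne e.symm⟩)
          rcases Nat.lt_or_ge a (o + l.numNodes) with h7 | h7
          · exact lt_asymm h6 (h2 a ha.1 h7)
          · exact lt_asymm h6 (h3 a (by omega) (by omega))
        subst this
        exact ⟨trivial, ⟨by omega, h4⟩, by omega, h5⟩

theorem bstShape_sort_eq_iff {κ : Type*} [LinearOrder κ] (key : ℕ → κ) (T : BinaryTree Unit)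
    (hkey : Function.Injective fun i : Fin T.numNodes => key i) :
    bstShape (Tuple.sort fun i : Fin T.numNodes => key i) = T ↔ HeapOrdered key 0 T := by
  rw [bstShape_eq_listShape, listShape_eq_iff key T 0 T.numNodes]
  · simp
  · rw [List.pairwise_ofFn]
    intro i j hij
    exact ((Tuple.monotone_sort fun i : Fin T.numNodes => key i).strictMono_of_injective
      (hkey.comp (Equiv.injective _))) hij
  · intro j
    rw [List.mem_ofFn]
    constructor
    · rintro ⟨i, rfl⟩
      simp
    · intro h
      exact ⟨(Tuple.sort fun i : Fin T.numNodes => key i).symm ⟨j, by omega⟩, by simp⟩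

theorem HeapOrdered.congr {κ κ' : Type*} [LinearOrder κ] [LinearOrder κ'] {key : ℕ → κ}
    {key' : ℕ → κ'} {T : BinaryTree Unit} : ∀ {o : ℕ},
    (∀ i j, o ≤ i → i < o + T.numNodes → o ≤ j → j < o + T.numNodes →
      (key i < key j ↔ key' i < key' j)) →
    HeapOrdered key o T → HeapOrdered key' o T := by
  induction T with
  | nil => exact fun _ _ => trivial
  | node u l r ihl ihr =>
    rintro o h ⟨h1, h2, h3, h4⟩
    simp only [BinaryTree.numNodes] at h
    refine ⟨fun j hj hj' => (h _ _ ?_ ?_ ?_ ?_).1 (h1 j hj hj'),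
      fun j hj hj' => (h _ _ ?_ ?_ ?_ ?_).1 (h2 j hj hj'),
      ihl (fun i j _ _ _ _ => h i j ?_ ?_ ?_ ?_) h3,
      ihr (fun i j _ _ _ _ => h i j ?_ ?_ ?_ ?_) h4⟩ <;> omega

/-! ### Heap-ordered fillings with signed labels -/

/-- The signed label of the node `x`. -/
def signedLabel (δ : ℕ → ℤˣ) (x : ℕ) : ℤ := (δ x : ℤ) * (x + 1)

theorem signedLabel_of_neg {δ : ℕ → ℤˣ} {x : ℕ} (h : δ x = -1) :
    signedLabel δ x = -(x + 1) := by
  simp [signedLabel, h]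

theorem signedLabel_of_pos {δ : ℕ → ℤˣ} {x : ℕ} (h : δ x = 1) :
    signedLabel δ x = x + 1 := by
  simp [signedLabel, h]

/-- The label of larger absolute value decides, whatever the sign of the other one. -/
theorem signedLabel_lt_iff {δ : ℕ → ℤˣ} {x y : ℕ} (h : x < y) :
    signedLabel δ x < signedLabel δ y ↔ δ y = 1 := by
  rcases Int.units_eq_one_or (δ x) with hx | hx <;> rcases Int.units_eq_one_or (δ y) with hy | hy
  all_goals
    simp only [hx, hy, signedLabel_of_neg, signedLabel_of_pos]
    first
    | (simp only [iff_true]; omega)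
    | (rw [iff_false_right (by decide)]; omega)

theorem signedLabel_gt_iff {δ : ℕ → ℤˣ} {x y : ℕ} (h : x < y) :
    signedLabel δ y < signedLabel δ x ↔ δ y = -1 := by
  rcases Int.units_eq_one_or (δ x) with hx | hx <;> rcases Int.units_eq_one_or (δ y) with hy | hy
  all_goals
    simp only [hx, hy, signedLabel_of_neg, signedLabel_of_pos]
    first
    | (simp only [iff_true]; omega)
    | (rw [iff_false_right (by decide)]; omega)

theorem signedLabel_injective (δ : ℕ → ℤˣ) : Function.Injective (signedLabel δ) := by
  intro x y h
  rcases lt_trichotomy x y with hxy | hxy | hxy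
  · rcases Int.units_eq_one_or (δ y) with hy | hy
    · exact absurd h ((signedLabel_lt_iff hxy).2 hy).ne
    · exact absurd h ((signedLabel_gt_iff hxy).2 hy).ne'
  · exact hxy
  · rcases Int.units_eq_one_or (δ x) with hx | hx
    · exact absurd h ((signedLabel_lt_iff hxy).2 hx).ne'
    · exact absurd h ((signedLabel_gt_iff hxy).2 hx).ne

theorem signedLabel_val_injective (δ : ℕ → ℤˣ) (n : ℕ) :
    Function.Injective fun i : Fin n => signedLabel δ i :=
  (signedLabel_injective δ).comp Fin.val_injective

/-- The least difference between the values of the left descendants of `a` and of `a`. -/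
def leftGap (δ : ℕ → ℤˣ) (a : ℕ) : ℕ := if δ a = -1 then 1 else 0

/-- The least difference between the values of the nodes of a right subtree and of its father. -/
def rightGap (δ : ℕ → ℤˣ) (o : ℕ) : BinaryTree Unit → ℕ
  | .nil => 0
  | .node _ l _ => if δ (o + l.numNodes) = -1 then 0 else 1

theorem HeapOrdered.shift {f g : ℕ → ℕ} {ω : ℕ → ℤ} {o c : ℕ} {T : BinaryTree Unit}
    (h : ∀ x, o ≤ x → x < o + T.numNodes → g x = f x + c)
    (hf : HeapOrdered (sortKey f ω) o T) : HeapOrdered (sortKey g ω) o T := by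
  refine hf.congr fun i j h1 h2 h3 h4 => ?_
  rw [sortKey_lt, sortKey_lt, h i h1 h2, h j h3 h4]
  omega

theorem sortKey_lt_iff_leftGap {f : ℕ → ℕ} {δ : ℕ → ℤˣ} {j a : ℕ} (h : j < a) :
    sortKey f (signedLabel δ) j < sortKey f (signedLabel δ) a ↔ f a + leftGap δ a ≤ f j := by
  rw [sortKey_lt, signedLabel_lt_iff h, leftGap]
  rcases Int.units_eq_one_or (δ a) with ha | ha
  · simp only [ha, show (1 : ℤˣ) ≠ -1 by decide, if_false, eq_self, and_true]; omega
  · simp only [ha, show (-1 : ℤˣ) ≠ 1 by decide, if_true, and_false, or_false, eq_self]; omega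

/-- In a heap only the root of the right subtree has to be compared with `a`. Its label exceeds `a`,
so its own sign settles a tie; this is why right sons have a different factor. -/
theorem forall_sortKey_lt_iff_rightGap {f : ℕ → ℕ} {δ : ℕ → ℤˣ} {a o : ℕ} (hao : a < o)
    {T : BinaryTree Unit} (hT : HeapOrdered (sortKey f (signedLabel δ)) o T) :
    (∀ j, o ≤ j → j < o + T.numNodes →
      sortKey f (signedLabel δ) j < sortKey f (signedLabel δ) a) ↔
    ∀ j, o ≤ j → j < o + T.numNodes → f a + rightGap δ o T ≤ f j := by
  cases T with
  | nil =>
    simp only [BinaryTree.numNodes]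
    exact ⟨fun _ j _ _ => by omega, fun _ j _ _ => by omega⟩
  | node u l r =>
    have hb : ∀ j, o ≤ j → j < o + (BinaryTree.node u l r).numNodes →
        sortKey f (signedLabel δ) j ≤ sortKey f (signedLabel δ) (o + l.numNodes) := by
      intro j h1 h2
      simp only [BinaryTree.numNodes] at h2
      rcases lt_trichotomy j (o + l.numNodes) with h | h | h
      · exact (hT.1 j h1 h).le
      · rw [h]
      · exact (hT.2.1 j (by omega) (by omega)).le
    have hroot : sortKey f (signedLabel δ) (o + l.numNodes) < sortKey f (signedLabel δ) a ↔
        f a + rightGap δ o (.node u l r) ≤ f (o + l.numNodes) := by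
      rw [sortKey_lt, signedLabel_gt_iff (by omega), rightGap]
      split_ifs with h <;> simp only [h, eq_self, and_true, and_false, or_false] <;> omega
    constructor
    · intro H j h1 h2
      refine (hroot.1 (H _ (by omega) ?_)).trans ?_
      · simp only [BinaryTree.numNodes]; omega
      · have := sortKey_le.1 (hb j h1 h2)
        omega
    · intro H j h1 h2
      refine (hb j h1 h2).trans_lt (hroot.2 (H _ (by omega) ?_))
      simp only [BinaryTree.numNodes]; omega

/-- The conditions linking the root to its subtrees become uniform lower bounds, which a shift of
each subtree removes. -/
theorem heapOrdered_node_iff {f : ℕ → ℕ} {δ : ℕ → ℤˣ} {o : ℕ} {u : Unit}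
    {l r : BinaryTree Unit} :
    HeapOrdered (sortKey f (signedLabel δ)) o (.node u l r) ↔
      (∀ j, o ≤ j → j < o + l.numNodes →
        f (o + l.numNodes) + leftGap δ (o + l.numNodes) ≤ f j) ∧
      (∀ j, o + l.numNodes + 1 ≤ j → j < o + l.numNodes + 1 + r.numNodes →
        f (o + l.numNodes) + rightGap δ (o + l.numNodes + 1) r ≤ f j) ∧
      HeapOrdered (sortKey f (signedLabel δ)) o l ∧
      HeapOrdered (sortKey f (signedLabel δ)) (o + l.numNodes + 1) r := by
  rw [HeapOrdered]
  constructor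
  · rintro ⟨h1, h2, h3, h4⟩
    exact ⟨fun j hj hj' => (sortKey_lt_iff_leftGap hj').1 (h1 j hj hj'),
      (forall_sortKey_lt_iff_rightGap (by omega) h4).1 h2, h3, h4⟩
  · rintro ⟨h1, h2, h3, h4⟩
    exact ⟨fun j hj hj' => (sortKey_lt_iff_leftGap hj').2 (h1 j hj hj'),
      (forall_sortKey_lt_iff_rightGap (by omega) h4).2 h2, h3, h4⟩

/-- The heap-ordered fillings of a tree whose nodes are numbered from `o` on, extended by `0`. -/
abbrev HeapFilling (δ : ℕ → ℤˣ) (o : ℕ) (T : BinaryTree Unit) : Type :=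
  {f : ℕ → ℕ // HeapOrdered (sortKey f (signedLabel δ)) o T ∧
    ∀ x, ¬ (o ≤ x ∧ x < o + T.numNodes) → f x = 0}

/-- The sum of the values of a filling. -/
def HeapFilling.weight {δ : ℕ → ℤˣ} {o : ℕ} {T : BinaryTree Unit} (f : HeapFilling δ o T) : ℕ :=
  ∑ x ∈ Ico o (o + T.numNodes), f.1 x

theorem HeapFilling.finite_fiber (δ : ℕ → ℤˣ) (o : ℕ) (T : BinaryTree Unit) (d : ℕ) :
    Finite {f : HeapFilling δ o T // f.weight = d} := by
  have := finite_sum_fiber (ι := Fin T.numNodes) d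
  refine Finite.of_injective (β := {g : Fin T.numNodes → ℕ // ∑ i, g i = d})
    (fun f => ⟨fun i => f.1.1 (o + i), ?_⟩) ?_
  · refine Eq.trans ?_ f.2
    rw [weight, sum_Ico_eq_sum_range, Nat.add_sub_cancel_left,
      Fin.sum_univ_eq_sum_range (fun i => f.1.1 (o + i))]
  · rintro ⟨⟨f, hf, hf'⟩, _⟩ ⟨⟨g, hg, hg'⟩, _⟩ h
    refine Subtype.ext (Subtype.ext (funext fun x => ?_))
    by_cases hx : o ≤ x ∧ x < o + T.numNodes
    · have := congrFun (Subtype.mk.inj h) ⟨x - o, by omega⟩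
      simpa [Nat.add_sub_cancel' hx.1] using this
    · exact (hf' x hx).trans (hg' x hx).symm

/-- The function obtained by gluing fillings of the subtrees to a value `m` of the root. -/
def glueFun (δ : ℕ → ℤˣ) (o : ℕ) (l r : BinaryTree Unit) (m : ℕ) (f g : ℕ → ℕ) (x : ℕ) : ℕ :=
  if x < o then 0
  else if x < o + l.numNodes then f x + (m + leftGap δ (o + l.numNodes))
  else if x = o + l.numNodes then m
  else if x < o + l.numNodes + 1 + r.numNodes then
    g x + (m + rightGap δ (o + l.numNodes + 1) r)
  else 0

section glue

variable {δ : ℕ → ℤˣ} {o : ℕ} {l r : BinaryTree Unit} {m : ℕ} {f g : ℕ → ℕ} {x : ℕ}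

theorem glueFun_left (h : o ≤ x) (h' : x < o + l.numNodes) :
    glueFun δ o l r m f g x = f x + (m + leftGap δ (o + l.numNodes)) := by
  rw [glueFun, if_neg (by omega), if_pos h']

theorem glueFun_root : glueFun δ o l r m f g (o + l.numNodes) = m := by
  rw [glueFun, if_neg (by omega), if_neg (by omega), if_pos rfl]

theorem glueFun_right (h : o + l.numNodes + 1 ≤ x) (h' : x < o + l.numNodes + 1 + r.numNodes) :
    glueFun δ o l r m f g x = g x + (m + rightGap δ (o + l.numNodes + 1) r) := by
  rw [glueFun, if_neg (by omega), if_neg (by omega), if_neg (by omega), if_pos h']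

theorem glueFun_outside (h : ¬ (o ≤ x ∧ x < o + l.numNodes + 1 + r.numNodes)) :
    glueFun δ o l r m f g x = 0 := by
  unfold glueFun
  split_ifs <;> first | rfl | omega

end glue

/-- A filling of a nonempty tree is given by the value of the root and the shifted fillings of the
subtrees. -/
def glue (δ : ℕ → ℤˣ) (o : ℕ) (u : Unit) (l r : BinaryTree Unit)
    (x : ℕ × HeapFilling δ o l × HeapFilling δ (o + l.numNodes + 1) r) :
    HeapFilling δ o (.node u l r) :=
  ⟨glueFun δ o l r x.1 x.2.1.1 x.2.2.1, by
    refine ⟨heapOrdered_node_iff.2 ⟨?_, ?_, ?_, ?_⟩, ?_⟩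
    · intro j h1 h2
      rw [glueFun_root, glueFun_left h1 h2]
      omega
    · intro j h1 h2
      rw [glueFun_root, glueFun_right h1 h2]
      omega
    · exact x.2.1.2.1.shift fun j h1 h2 => glueFun_left h1 h2
    · exact x.2.2.2.1.shift fun j h1 h2 => glueFun_right h1 h2
    · intro j hj
      simp only [BinaryTree.numNodes] at hj
      exact glueFun_outside (by omega)⟩

theorem glue_bijective (δ : ℕ → ℤˣ) (o : ℕ) (u : Unit) (l r : BinaryTree Unit) :
    Function.Bijective (glue δ o u l r) := by
  constructor
  · rintro ⟨m, ⟨f, hf, hf'⟩, ⟨g, hg, hg'⟩⟩ ⟨m', ⟨f₁, hf₁, hf₁'⟩, ⟨g₁, hg₁, hg₁'⟩⟩ h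
    have h' := congrFun (Subtype.mk.inj h)
    obtain rfl : m = m' := by simpa [glueFun_root] using h' (o + l.numNodes)
    have e1 : f = f₁ := by
      funext x
      by_cases hx : o ≤ x ∧ x < o + l.numNodes
      · have := h' x
        simp only [glueFun_left hx.1 hx.2] at this
        omega
      · rw [hf' x hx, hf₁' x hx]
    have e2 : g = g₁ := by
      funext x
      by_cases hx : o + l.numNodes + 1 ≤ x ∧ x < o + l.numNodes + 1 + r.numNodes
      · have := h' x
        simp only [glueFun_right hx.1 hx.2] at this
        omega
      · rw [hg' x hx, hg₁' x hx]
    subst e1 e2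
    rfl
  · rintro ⟨f, hf, hf'⟩
    obtain ⟨h1, h2, h3, h4⟩ := heapOrdered_node_iff.1 hf
    simp only [BinaryTree.numNodes] at hf'
    -- Subtracting a common lower bound keeps all comparisons of keys, hence the heap order.
    have key : ∀ {p c : ℕ} {S : BinaryTree Unit},
        HeapOrdered (sortKey f (signedLabel δ)) p S →
        (∀ j, p ≤ j → j < p + S.numNodes → c ≤ f j) →
        HeapOrdered (sortKey (fun x => if p ≤ x ∧ x < p + S.numNodes then f x - c else 0)
          (signedLabel δ)) p S := by
      intro p c S hS hc
      refine hS.congr fun i j hi hi' hj hj' => ?_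
      have := hc i hi hi'
      have := hc j hj hj'
      simp only [sortKey_lt, hi, hi', hj, hj', and_self, if_true]
      omega
    refine ⟨⟨f (o + l.numNodes), ⟨_, key h3 h1, fun x hx => if_neg hx⟩,
      ⟨_, key h4 h2, fun x hx => if_neg hx⟩⟩, ?_⟩
    refine Subtype.ext (funext fun x => ?_)
    simp only [glue]
    by_cases hx : o ≤ x ∧ x < o + l.numNodes + 1 + r.numNodes
    · rcases lt_trichotomy x (o + l.numNodes) with h | rfl | h
      · rw [glueFun_left hx.1 h, if_pos ⟨hx.1, h⟩]
        have := h1 x hx.1 h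
        omega
      · rw [glueFun_root]
      · rw [glueFun_right (by omega) hx.2, if_pos ⟨by omega, hx.2⟩]
        have := h2 x (by omega) hx.2
        omega
    · rw [glueFun_outside hx, hf' x (by omega)]

theorem weight_glue (δ : ℕ → ℤˣ) (o : ℕ) (u : Unit) (l r : BinaryTree Unit)
    (x : ℕ × HeapFilling δ o l × HeapFilling δ (o + l.numNodes + 1) r) :
    (glue δ o u l r x).weight =
      (l.numNodes + r.numNodes + 1) * x.1 + (x.2.1.weight + x.2.2.weight) +
        (l.numNodes * leftGap δ (o + l.numNodes) +
          r.numNodes * rightGap δ (o + l.numNodes + 1) r) := by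
  have e : o + (BinaryTree.node u l r).numNodes = o + l.numNodes + 1 + r.numNodes := by
    simp only [BinaryTree.numNodes]; omega
  have hl : ∑ y ∈ Ico o (o + l.numNodes), glueFun δ o l r x.1 x.2.1.1 x.2.2.1 y =
      x.2.1.weight + l.numNodes * (x.1 + leftGap δ (o + l.numNodes)) := by
    rw [sum_congr rfl fun y hy => glueFun_left (mem_Ico.1 hy).1 (mem_Ico.1 hy).2,
      sum_add_distrib, sum_const, Nat.card_Ico, Nat.add_sub_cancel_left, smul_eq_mul]
    rfl
  have hr : ∑ y ∈ Ico (o + l.numNodes + 1) (o + l.numNodes + 1 + r.numNodes),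
      glueFun δ o l r x.1 x.2.1.1 x.2.2.1 y =
      x.2.2.weight + r.numNodes * (x.1 + rightGap δ (o + l.numNodes + 1) r) := by
    rw [sum_congr rfl fun y hy => glueFun_right (mem_Ico.1 hy).1 (mem_Ico.1 hy).2,
      sum_add_distrib, sum_const, Nat.card_Ico, Nat.add_sub_cancel_left, smul_eq_mul]
    rfl
  change ∑ y ∈ Ico o (o + (BinaryTree.node u l r).numNodes),
    glueFun δ o l r x.1 x.2.1.1 x.2.2.1 y = _
  rw [e, ← sum_Ico_consecutive _ (show o ≤ o + l.numNodes + 1 by omega) (by omega),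
    sum_Ico_succ_top (by omega), hl, hr, glueFun_root]
  ring

/-- The contribution of a node when the signs of the labels are fixed. -/
def signedHook (K : Type*) [Field K] (δ : ℕ → ℤˣ) (s : NodeData) : K⟦X⟧ :=
  (if δ (s.label - 1) = -1 then X ^ s.leftSize else if s.isRightSon then X ^ s.size else 1) *
    (1 - X ^ s.size)⁻¹

/-- Only the root of the subtree sees the flag: it gains `X ^ size` exactly when it is positive,
that is, when `rightGap` is `1`. -/
theorem prod_signedHook_right (K : Type*) [Field K] (δ : ℕ → ℤˣ) (o : ℕ) (T : BinaryTree Unit) :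
    ((nodesAux o true T).map (signedHook K δ)).prod =
      X ^ (T.numNodes * rightGap δ o T) * ((nodesAux o false T).map (signedHook K δ)).prod := by
  cases T with
  | nil => simp [nodesAux, rightGap]
  | node u l r =>
    simp only [nodesAux, List.map_append, List.map_cons, List.prod_append, List.prod_cons,
      signedHook, rightGap, Nat.add_sub_cancel, BinaryTree.numNodes]
    simp only [if_true, Bool.false_eq_true, if_false]
    split_ifs <;> simp only [mul_zero, mul_one, pow_zero] <;> ring

/-- By `glue`, the root value is added at every node and gives the geometric series in `X ^ size`.
The left gap gives the root's `X ^ leftSize`, and the right gap is absorbed in the factor of the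
right son. -/
theorem weightGF_heapFilling (K : Type*) [Field K] (δ : ℕ → ℤˣ) (T : BinaryTree Unit) :
    ∀ o, weightGF K (HeapFilling.weight (δ := δ) (o := o) (T := T)) =
      ((nodesAux o false T).map (signedHook K δ)).prod := by
  induction T with
  | nil =>
    intro o
    have : Unique (HeapFilling δ o .nil) :=
      ⟨⟨⟨fun _ => 0, trivial, fun _ _ => rfl⟩⟩, fun f => Subtype.ext (funext fun x =>
        f.2.2 x (by simp only [BinaryTree.numNodes]; omega))⟩
    rw [weightGF_unique]
    · rfl
    · simp [HeapFilling.weight, BinaryTree.numNodes]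
  | node u l r ihl ihr =>
    intro o
    rw [← weightGF_congr (Equiv.ofBijective _ (glue_bijective δ o u l r)) (fun a => rfl)]
    simp only [Equiv.ofBijective_apply, weight_glue]
    rw [weightGF_add_const,
      weightGF_prod (fun k => (l.numNodes + r.numNodes + 1) * k)
        (fun p : HeapFilling δ o l × HeapFilling δ (o + l.numNodes + 1) r =>
          p.1.weight + p.2.weight) (finite_mul_fiber (Nat.succ_pos _))
        (finite_prod_fiber (HeapFilling.finite_fiber _ _ _) (HeapFilling.finite_fiber _ _ _)),
      weightGF_prod _ _ (HeapFilling.finite_fiber _ _ _) (HeapFilling.finite_fiber _ _ _),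
      weightGF_nat (Nat.succ_pos _), ihl, ihr]
    simp only [nodesAux, List.map_append, List.map_cons, List.prod_append, List.prod_cons,
      prod_signedHook_right, pow_add]
    simp only [signedHook, Nat.add_sub_cancel, leftGap, Bool.false_eq_true, if_false]
    split_ifs <;> simp only [mul_zero, mul_one, pow_zero] <;> ring

/-- Functions whose sorting permutation has shape `T` are the heap-ordered fillings of `T`. -/
def heapFillingEquiv (δ : ℕ → ℤˣ) (T : BinaryTree Unit) :
    {f : Fin T.numNodes → ℕ //
      bstShape (Tuple.sort (sortKey f fun i => signedLabel δ i)) = T} ≃ HeapFilling δ 0 T where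
  toFun f := ⟨fun x => if h : x < T.numNodes then f.1 ⟨x, h⟩ else 0, by
    refine ⟨?_, fun x hx => dif_neg (by omega)⟩
    rw [← bstShape_sort_eq_iff]
    · convert f.2 using 3
      funext i
      simp [sortKey]
    · intro i j h
      exact Fin.val_injective (sortKey_injective (signedLabel_injective δ) h)⟩
  invFun f := ⟨fun i => f.1 i, (bstShape_sort_eq_iff _ T fun i j h =>
    Fin.val_injective (sortKey_injective (signedLabel_injective δ) h)).2 f.2.1⟩
  left_inv f := by
    refine Subtype.ext (funext fun i => ?_)
    simp
  right_inv f := by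
    refine Subtype.ext (funext fun x => ?_)
    by_cases h : x < T.numNodes
    · simp [h]
    · simpa [h] using (f.2.2 x (by omega)).symm

/-- The functions sorted by the various `σ` of shape `T` together form the heap-ordered fillings of
`T`. -/
theorem sum_maj_signedLabel (K : Type*) [Field K] (δ : ℕ → ℤˣ) (T : BinaryTree Unit) :
    ∑ σ : Equiv.Perm (Fin T.numNodes) with bstShape σ = T,
        (X : K⟦X⟧) ^ maj (fun i => signedLabel δ (σ i)) =
      qPoch K T.numNodes * ((nodes T).map (signedHook K δ)).prod := by
  refine (sum_congr rfl fun σ _ =>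
    (qPoch_mul_weightGF_sort K (signedLabel_val_injective δ _) σ).symm).trans ?_
  rw [← mul_sum]
  congr 1
  rw [sum_weightGF_fiber (fun f : Fin T.numNodes → ℕ => ∑ i, f i) finite_sum_fiber
      (fun f => Tuple.sort (sortKey f fun i : Fin T.numNodes => signedLabel δ i))
      (fun σ => bstShape σ = T), nodes, ← weightGF_heapFilling]
  refine weightGF_congr (heapFillingEquiv δ T) fun f => ?_
  rw [HeapFilling.weight, sum_Ico_eq_sum_range, Nat.add_sub_cancel_left,
    ← Fin.sum_univ_eq_sum_range (fun x => (heapFillingEquiv δ T f).1 (0 + x))]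
  simp [heapFillingEquiv]

/-! ### Summation over the signs -/

/-- The extension by `1` of a sequence of signs. -/
def extendSigns {n : ℕ} (δ : Fin n → ℤˣ) (x : ℕ) : ℤˣ := if h : x < n then δ ⟨x, h⟩ else 1

@[simp]
theorem extendSigns_val {n : ℕ} (δ : Fin n → ℤˣ) (x : Fin n) : extendSigns δ x = δ x := by
  simp [extendSigns]

/-- The substitution `ε = δ ∘ σ` makes the weight of the signs independent of `σ`, so that the sum
over `σ` can be taken first. -/
theorem sum_signs_eq_sum_label_signs {K : Type*} [Field K] {n : ℕ} (u : ℕ → K)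
    (σ : Equiv.Perm (Fin n)) :
    ∑ ε : Fin n → ℤˣ, (∏ i : Fin n with ε i = -1, C (u ((σ i : ℕ) + 1))) *
        X ^ maj (signedWord σ ε) =
      ∑ δ : Fin n → ℤˣ, (∏ x : Fin n with δ x = -1, C (u ((x : ℕ) + 1))) *
        X ^ maj (fun i => signedLabel (extendSigns δ) (σ i)) := by
  rw [← Equiv.sum_comp (σ.symm.arrowCongr (Equiv.refl ℤˣ))]
  refine sum_congr rfl fun δ _ => ?_
  congr 1
  · rw [prod_filter, prod_filter,
      ← Equiv.prod_comp σ fun x => if δ x = -1 then C (u ((x : ℕ) + 1)) else 1]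
    rfl
  · congr 2
    funext i
    simp [signedWord, signedLabel]

theorem map_label_nodesAux (T : BinaryTree Unit) :
    ∀ o b, (nodesAux o b T).map NodeData.label = List.range' (o + 1) T.numNodes := by
  induction T with
  | nil => exact fun _ _ => rfl
  | node u l r ihl ihr =>
    intro o b
    have h : l.numNodes + r.numNodes + 1 = l.numNodes + (r.numNodes + 1) := by omega
    rw [nodesAux, List.map_append, List.map_cons, ihl, ihr, BinaryTree.numNodes, h,
      ← List.range'_append_1, List.range'_succ]
    congr 2 <;> ring_nf

/-- Infix order is label order, so a product over nodes becomes a product over `Fin n`, which can be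
expanded over sign vectors. -/
theorem exists_nodes_eq_ofFn (T : BinaryTree Unit) :
    ∃ N : Fin T.numNodes → NodeData, nodes T = List.ofFn N ∧ ∀ x, (N x).label = x + 1 := by
  have h := map_label_nodesAux T 0 false
  have hlen : (nodes T).length = T.numNodes := by
    have := congrArg List.length h
    simpa [nodes] using this
  refine ⟨fun x => (nodes T)[(x : ℕ)]'(by omega), ?_, fun x => ?_⟩
  · refine List.ext_getElem (by simp [hlen]) fun i h1 h2 => ?_
    simp
  · have h1 := List.getElem_of_eq h (i := x) (by
      rw [List.length_map]; exact x.2.trans_eq hlen.symm)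
    simp only [List.getElem_map, List.getElem_range'] at h1
    simpa [nodes, add_comm] using h1

theorem hookContent_eq_sum {K : Type*} [Field K] (u : K) (s : NodeData) :
    hookContent u s = ∑ e : ℤˣ, (if e = -1 then C (-u) else 1) *
      ((if e = -1 then X ^ s.leftSize else if s.isRightSon then X ^ s.size else 1) *
        (1 - X ^ s.size)⁻¹) := by
  rw [UnitsInt.univ, sum_pair (by decide)]
  simp only [show (1 : ℤˣ) ≠ -1 by decide, if_false, if_true, map_neg, hookContent]
  ring

theorem signedGFLabels_eq {K : Type*} [Field K] (u : ℕ → K) (T : BinaryTree Unit) :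
    signedGFLabels (fun j => -u j) T =
      qPoch K T.numNodes * ((nodes T).map fun s => hookContent (u s.label) s).prod := by
  obtain ⟨N, hN, hlabel⟩ := exists_nodes_eq_ofFn T
  rw [signedGFLabels,
    sum_congr rfl fun σ _ => sum_signs_eq_sum_label_signs (fun j => -u j) σ, sum_comm]
  simp only [← mul_sum, sum_maj_signedLabel, hN, List.map_ofFn, List.prod_ofFn,
    Function.comp_apply, hookContent_eq_sum]
  rw [prod_univ_sum, Fintype.piFinset_univ, mul_sum]
  refine sum_congr rfl fun δ _ => ?_
  rw [prod_mul_distrib, prod_filter, mul_left_comm]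
  simp [signedHook, hlabel]

theorem signedGF_eq_signedGFLabels {K : Type*} [Field K] (t : K) (T : BinaryTree Unit) :
    signedGF t T = signedGFLabels (fun _ => t) T := by
  simp [signedGF, signedGFLabels, numNeg, prod_const]

/-! ### The specialization at `1/(1-q)` -/

theorem sort_toDual_eq {n : ℕ} (w : Fin n → ℕ) :
    Tuple.sort (fun i => OrderDual.toDual (w i)) = Tuple.sort (sortKey w fun i => (i : ℤ)) := by
  symm
  have hinj : Function.Injective fun i : Fin n => ((i : ℕ) : ℤ) :=
    Nat.cast_injective.comp Fin.val_injective
  rw [sort_eq_iff_of_injective (sortKey_injective hinj)]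
  obtain ⟨h1, h2⟩ := Tuple.eq_sort_iff.1
    (rfl : Tuple.sort (fun i => OrderDual.toDual (w i)) = _)
  intro i j hij
  rcases hij.eq_or_lt with rfl | hij
  · exact le_rfl
  refine sortKey_le.2 ?_
  have h3 := h1 hij.le
  simp only [Function.comp_apply, OrderDual.toDual_le_toDual] at h3
  rcases h3.lt_or_eq with h | h
  · exact Or.inl h
  · exact Or.inr ⟨h.symm, by exact_mod_cast (h2 i j hij (by simp [h])).le⟩

theorem specGeom_eq_sum {K : Type*} [Field K] {n : ℕ} (x : FQSym K n) :
    specGeom x = ∑ τ : Equiv.Perm (Fin n), C (x.coeff τ) * weightGF K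
      (fun f : {f : Fin n → ℕ // Tuple.sort (sortKey f fun i => (i : ℤ)) = τ} => ∑ i, f.1 i) := by
  ext d
  simp only [specGeom, coeff_mk, map_sum, coeff_C_mul, weightGF, gCoeff, std, inv_inv,
    sort_toDual_eq]
  rw [← sum_fiberwise (Finset.Nat.antidiagonalTuple n d)
    fun w => Tuple.sort (sortKey w fun i => (i : ℤ))]
  refine sum_congr rfl fun τ _ => ?_
  rw [sum_congr rfl fun w hw => by rw [(mem_filter.1 hw).2], sum_const, nsmul_eq_mul, mul_comm]
  congr 2
  rw [Nat.card_congr (Equiv.subtypeSubtypeEquivSubtypeInter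
    (fun f : Fin n → ℕ => Tuple.sort (sortKey f fun i => (i : ℤ)) = τ) (fun f => ∑ i, f i = d))]
  refine (Nat.subtype_card _ fun w => ?_).symm
  rw [mem_filter, Finset.Nat.mem_antidiagonalTuple, and_comm]

/-- Standardization breaks ties from left to right, so this is `qPoch_mul_weightGF_sort` with the
positions themselves as `ω`. -/
theorem qPoch_mul_specGeom {K : Type*} [Field K] {n : ℕ} (x : FQSym K n) :
    qPoch K n * specGeom x =
      ∑ τ : Equiv.Perm (Fin n), C (x.coeff τ) * X ^ maj (fun i => (τ i : ℤ)) := by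
  have hinj : Function.Injective fun i : Fin n => ((i : ℕ) : ℤ) :=
    Nat.cast_injective.comp Fin.val_injective
  rw [specGeom_eq_sum, mul_sum]
  refine sum_congr rfl fun τ _ => ?_
  rw [mul_left_comm, qPoch_mul_weightGF_sort K hinj]
  rfl

/-! ### The transformation `A ↦ A·(1-t)` -/

theorem gCoeff_G {K : Type*} [Field K] {n : ℕ} (σ τ : Equiv.Perm (Fin n)) :
    gCoeff (G K σ) τ = if τ = σ then 1 else 0 := by
  simp [gCoeff, G, F, Finsupp.single_apply, eq_comm]

theorem gCoeff_outer {K : Type*} [Field K] {k l n : ℕ} (h : k + l = n) (x : FQSym K k)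
    (y : FQSym K l) (γ : Equiv.Perm (Fin n)) :
    gCoeff (outer h x y) γ =
      gCoeff x (std fun i : Fin k => γ (Fin.cast h (Fin.castAdd l i))) *
        gCoeff y (std fun j : Fin l => γ (Fin.cast h (Fin.natAdd k j))) := by
  simp [gCoeff, outer, G, F, MonoidAlgebra.coeff_sum, Finsupp.finsetSum_apply,
    Finsupp.single_apply]

theorem std_eq_one_iff {α : Type*} [LinearOrder α] {n : ℕ} {w : Fin n → α}
    (hw : Function.Injective w) : std w = 1 ↔ StrictMono w := by
  rw [std, inv_eq_one, sort_eq_iff_of_injective hw]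
  exact ⟨fun h => h.strictMono_of_injective hw, fun h => h.monotone⟩

theorem std_eq_revPerm_iff {α : Type*} [LinearOrder α] {n : ℕ} {w : Fin n → α}
    (hw : Function.Injective w) : std w = Fin.revPerm ↔ StrictAnti w := by
  rw [std, inv_eq_iff_eq_inv, sort_eq_iff_of_injective hw]
  constructor
  · intro h i j hij
    have := (h.strictMono_of_injective (hw.comp (Equiv.injective _))) (Fin.rev_lt_rev.2 hij)
    simpa using this
  · intro h i j hij
    exact h.antitone (Fin.rev_le_rev.2 hij)

/-- `γ` is decreasing on the first `k` positions and increasing on the other ones. -/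
def Valley {n : ℕ} (k : ℕ) (γ : Equiv.Perm (Fin n)) : Prop :=
  (∀ i j : Fin n, i < j → (j : ℕ) < k → γ j < γ i) ∧ ∀ i j : Fin n, k ≤ (i : ℕ) → i < j → γ i < γ j

-- `Λ_k S_l` is the sum of the `G_γ` that decrease on the first `k` positions and increase on the
-- others.
open Classical in
theorem gCoeff_completeOneSub {K : Type*} [Field K] (t : K) {n : ℕ} (γ : Equiv.Perm (Fin n)) :
    gCoeff (completeOneSub t n) γ = ∑ k ∈ range (n + 1) with Valley k γ, (-t) ^ k := by
  have h1 : gCoeff (completeOneSub t n) γ = ∑ p ∈ (antidiagonal n).attach,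
      if Valley p.1.1 γ then (-t) ^ p.1.1 else 0 := by
    have : ∀ p ∈ (antidiagonal n).attach, (-t) ^ p.1.1 * gCoeff
        (outer (mem_antidiagonal.1 p.2) (elemLambda K p.1.1) (completeS K p.1.2)) γ =
        if Valley p.1.1 γ then (-t) ^ p.1.1 else 0 := by
      rintro ⟨⟨k, l⟩, hp⟩ -
      obtain rfl : k + l = n := mem_antidiagonal.1 hp
      simp only [gCoeff_outer, elemLambda, completeS, gCoeff_G]
      have hinj : Function.Injective fun i : Fin k => γ (Fin.castAdd l i) :=
        γ.injective.comp (Fin.castAdd_injective _ _)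
      have hinj' : Function.Injective fun j : Fin l => γ (Fin.natAdd k j) :=
        γ.injective.comp (Fin.natAdd_injective _ _)
      have hV : (std (fun i : Fin k => γ (Fin.castAdd l i)) = Fin.revPerm ∧
          std (fun j : Fin l => γ (Fin.natAdd k j)) = 1) ↔ Valley k γ := by
        rw [std_eq_one_iff hinj', std_eq_revPerm_iff hinj]
        refine and_congr ⟨fun H i j hij hj => ?_, fun H i j hij => ?_⟩
          ⟨fun H i j hi hij => ?_, fun H i j hij => ?_⟩
        · exact H (a := ⟨i, by omega⟩) (b := ⟨j, hj⟩) hij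
        · exact H _ _ hij j.2
        · have := H (a := ⟨i - k, by omega⟩) (b := ⟨j - k, by omega⟩) (by
            simp only [Fin.mk_lt_mk]; omega)
          have e : ∀ (x : Fin (k + l)) (hx : k ≤ (x : ℕ)),
              Fin.natAdd k (⟨x - k, by omega⟩ : Fin l) = x := fun x hx => by
            ext; simp only [Fin.natAdd_mk]; omega
          dsimp only at this
          rwa [e i hi, e j (hi.trans (Nat.le_of_lt hij))] at this
        · exact H _ _ (by simp) (by simpa using hij)
      simp only [Fin.cast_eq_self, ← hV]
      split_ifs <;> simp_all
    rw [← sum_congr rfl this]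
    simp [gCoeff, completeOneSub, MonoidAlgebra.coeff_sum, Finsupp.finsetSum_apply]
  rw [h1, sum_attach (antidiagonal n) fun p => if Valley p.1 γ then (-t) ^ p.1 else 0,
    Finset.Nat.sum_antidiagonal_eq_sum_range_succ fun k _ => if Valley k γ then (-t) ^ k else 0,
    sum_filter]

theorem mem_iff_lt_card_of_isLowerSet {n : ℕ} {S : Finset (Fin n)}
    (hS : IsLowerSet (S : Set (Fin n))) (i : Fin n) : i ∈ S ↔ (i : ℕ) < #S := by
  constructor
  · intro hi
    have : Iic i ⊆ S := fun j hj => hS (mem_Iic.1 hj) hi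
    have := card_le_card this
    rw [Fin.card_Iic] at this
    omega
  · intro hi
    by_contra h
    have : S ⊆ Iio i := fun j hj => mem_Iio.2 (lt_of_not_ge fun hij => h (hS hij hj))
    have := card_le_card this
    rw [Fin.card_Iio] at this
    omega

/-- The signs of the labels which are negative exactly on the first `k` letters of `γ`. -/
def valleySigns {n : ℕ} (γ : Equiv.Perm (Fin n)) (k : ℕ) (x : Fin n) : ℤˣ :=
  if ((γ.symm x : Fin n) : ℕ) < k then -1 else 1

theorem numNeg_valleySigns {n : ℕ} (γ : Equiv.Perm (Fin n)) {k : ℕ} (hk : k ≤ n) :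
    numNeg (valleySigns γ k) = k := by
  have h : #{x : Fin n | valleySigns γ k x = -1} = #{i : Fin n | (i : ℕ) < k} := by
    refine card_equiv γ.symm fun x => ?_
    simp [valleySigns]
  rw [numNeg, h, Fin.card_filter_val_lt, min_eq_right hk]

theorem neg_iff_lt_numNeg_of_monotone {n : ℕ} {γ : Equiv.Perm (Fin n)} {δ : Fin n → ℤˣ}
    (h : Monotone fun i => signedLabel (extendSigns δ) (γ i)) (i : Fin n) :
    δ (γ i) = -1 ↔ (i : ℕ) < numNeg δ := by
  have h1 : numNeg δ = #{i : Fin n | δ (γ i) = -1} := by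
    rw [numNeg]
    exact card_equiv γ.symm fun x => by simp
  rw [h1, ← mem_iff_lt_card_of_isLowerSet]
  · simp
  · intro j i hij hj
    simp only [coe_filter, mem_univ, true_and, Set.mem_ofPred_eq] at hj ⊢
    by_contra hi
    have hi := (Int.units_eq_one_or (δ (γ i))).resolve_right hi
    have h2 := h hij
    simp only [signedLabel, extendSigns_val, hi, hj] at h2
    push_cast at h2
    omega

theorem sort_signedLabel_eq_iff {n : ℕ} {γ : Equiv.Perm (Fin n)} {δ : Fin n → ℤˣ} :
    Tuple.sort (fun i : Fin n => signedLabel (extendSigns δ) i) = γ ↔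
      Monotone fun i => signedLabel (extendSigns δ) (γ i) := by
  rw [sort_eq_iff_of_injective (signedLabel_val_injective _ n)]
  rfl

/-- Sorted signed labels list the negative ones by decreasing absolute value, then the positive ones
in increasing order. For fixed `γ`, a valley position `k` thus amounts to making the first `k`
letters of `γ` negative. -/
theorem gCoeff_completeOneSub_eq_sum_signs {K : Type*} [Field K] (t : K) {n : ℕ}
    (γ : Equiv.Perm (Fin n)) :
    gCoeff (completeOneSub t n) γ =
      ∑ δ : Fin n → ℤˣ with Tuple.sort (fun i : Fin n => signedLabel (extendSigns δ) i) = γ,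
        (-t) ^ numNeg δ := by
  classical
  rw [gCoeff_completeOneSub]
  refine sum_nbij' (valleySigns γ) numNeg ?_ ?_ ?_ ?_ ?_
  · intro k hk
    obtain ⟨-, h1, h2⟩ := mem_filter.1 hk
    rw [mem_filter, sort_signedLabel_eq_iff]
    refine ⟨mem_univ _, fun i j hij => ?_⟩
    rcases hij.eq_or_lt with rfl | hij
    · exact le_rfl
    simp only [signedLabel, extendSigns_val, valleySigns, Equiv.symm_apply_apply]
    have h3 := h1 i j hij
    have h4 := h2 i j
    split_ifs <;> push_cast <;> omega
  · intro δ hδ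
    rw [mem_filter, sort_signedLabel_eq_iff] at hδ
    have hδ := hδ.2
    have hv := neg_iff_lt_numNeg_of_monotone hδ
    have hmono : StrictMono fun i => signedLabel (extendSigns δ) (γ i) :=
      hδ.strictMono_of_injective
        ((signedLabel_val_injective _ n).comp γ.injective)
    refine mem_filter.2 ⟨mem_range.2 (Nat.lt_succ_of_le ?_), fun i j hij hj => ?_,
      fun i j hi hij => ?_⟩
    · exact (card_le_univ _).trans_eq (Fintype.card_fin n)
    · have h1 := hmono hij
      have hi : δ (γ i) = -1 := (hv i).2 (lt_trans hij hj)
      simp only [signedLabel, extendSigns_val, hi, (hv j).2 hj] at h1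
      push_cast at h1
      omega
    · have h1 := hmono hij
      have hi' : δ (γ i) = 1 :=
        (Int.units_eq_one_or _).resolve_right fun h => absurd ((hv i).1 h) (by omega)
      have hj' : δ (γ j) = 1 :=
        (Int.units_eq_one_or _).resolve_right fun h => absurd ((hv j).1 h) (by omega)
      simp only [signedLabel, extendSigns_val, hi', hj'] at h1
      push_cast at h1
      omega
  · intro k hk
    exact numNeg_valleySigns γ (Nat.lt_succ_iff.1 (mem_range.1 (mem_filter.1 hk).1))
  · intro δ hδ
    rw [mem_filter, sort_signedLabel_eq_iff] at hδ
    funext x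
    have h := neg_iff_lt_numNeg_of_monotone hδ.2 (γ.symm x)
    rw [Equiv.apply_symm_apply] at h
    rw [valleySigns]
    split_ifs with h1
    · exact (h.2 h1).symm
    · exact ((Int.units_eq_one_or _).resolve_right fun h2 => h1 (h.1 h2)).symm
  · intro k hk
    rw [numNeg_valleySigns γ (Nat.lt_succ_iff.1 (mem_range.1 (mem_filter.1 hk).1))]

theorem maj_congr {n : ℕ} {v w : Fin n → ℤ} (h : ∀ i j, v i < v j ↔ w i < w j) :
    maj v = maj w := by
  simp only [maj, h]

/-- `(Tuple.sort ω)⁻¹` replaces each label by the rank of its `ω`-value, which preserves all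
comparisons. -/
theorem maj_sort_inv_mul {n : ℕ} {ω : Fin n → ℤ} (hω : Function.Injective ω)
    (σ : Equiv.Perm (Fin n)) :
    maj (fun i => ((((Tuple.sort ω)⁻¹ * σ) i : Fin n) : ℤ)) = maj (fun i => ω (σ i)) := by
  refine maj_congr fun i j => ?_
  have hmono : StrictMono (ω ∘ Tuple.sort ω) :=
    (Tuple.monotone_sort ω).strictMono_of_injective (hω.comp (Equiv.injective _))
  have := hmono.lt_iff_lt (a := (Tuple.sort ω)⁻¹ (σ i)) (b := (Tuple.sort ω)⁻¹ (σ j))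
  simp only [Function.comp_apply, ← Equiv.Perm.mul_apply, mul_inv_cancel_left] at this
  rw [this]
  simp

/-- The coefficient of `F_{σ⁻¹}` in `F_{τ⁻¹} * S` is that of `F_{τσ⁻¹} = G_{στ⁻¹}` in `S`. -/
theorem coeff_mulOneSub {K : Type*} [Field K] (t : K) {n : ℕ} (x : FQSym K n)
    (τ : Equiv.Perm (Fin n)) :
    (mulOneSub t x).coeff τ =
      ∑ σ : Equiv.Perm (Fin n), x.coeff σ * gCoeff (completeOneSub t n) (σ * τ⁻¹) := by
  simp [mulOneSub, pairing, oneSubMul, gCoeff, G, F, MonoidAlgebra.coeff_sum,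
    Finsupp.finsetSum_apply, Finsupp.single_apply]

theorem qPoch_mul_specX {K : Type*} [Field K] (t : K) {n : ℕ} (x : FQSym K n) :
    qPoch K n * specX t x = ∑ σ : Equiv.Perm (Fin n), C (x.coeff σ) *
      ∑ δ : Fin n → ℤˣ, C (-t) ^ numNeg δ *
        X ^ maj (fun i => signedLabel (extendSigns δ) (σ i)) := by
  rw [specX, qPoch_mul_specGeom]
  simp only [coeff_mulOneSub, map_sum, map_mul, sum_mul, mul_assoc]
  rw [sum_comm]
  refine sum_congr rfl fun σ _ => ?_
  rw [← mul_sum]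
  congr 1
  -- The substitution `τ = γ⁻¹ * σ` turns the argument `σ * τ⁻¹` into `γ`.
  rw [← Equiv.sum_comp ((Equiv.inv (Equiv.Perm (Fin n))).trans (Equiv.mulRight σ))]
  simp only [Equiv.trans_apply, Equiv.inv_apply, Equiv.coe_mulRight, mul_inv_rev, inv_inv,
    mul_inv_cancel_left, gCoeff_completeOneSub_eq_sum_signs, map_sum, map_pow, sum_mul]
  rw [← sum_fiberwise univ fun δ : Fin n → ℤˣ =>
    Tuple.sort (fun i : Fin n => signedLabel (extendSigns δ) i)]
  refine sum_congr rfl fun γ _ => sum_congr rfl fun δ hδ => ?_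
  obtain rfl := (mem_filter.1 hδ).2
  rw [maj_sort_inv_mul (signedLabel_val_injective _ n)]

theorem qPoch_mul_specX_P {K : Type*} [Field K] (t : K) (T : BinaryTree Unit) :
    qPoch K T.numNodes * specX t (P K T) = signedGF (-t) T := by
  have hP : ∀ σ, (P K T).coeff σ = if bstShape σ = T then 1 else 0 := by
    intro σ
    simp [P, F, MonoidAlgebra.coeff_sum, Finsupp.finsetSum_apply, Finsupp.single_apply]
  rw [qPoch_mul_specX, signedGF_eq_signedGFLabels, signedGFLabels, sum_filter]
  refine sum_congr rfl fun σ _ => ?_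
  rw [sum_signs_eq_sum_label_signs (fun _ => -t), hP]
  split_ifs
  · simp [numNeg, prod_const]
  · simp

theorem qPoch_ne_zero (K : Type*) [Field K] (n : ℕ) : qPoch K n ≠ 0 := by
  rw [qPoch, prod_ne_zero_iff]
  intro i _ h
  exact constantCoeff_one_sub_X_pow (K := K) i.succ_pos (by rw [h, map_zero])

end HookTree

end

theorem mainTheorem1 {K : Type*} [Field K] (T : BinaryTree Unit) (t : K) :
    -- `P_T(𝕏)` is the product of the hook-content factors of the nodes of `T`
    HookTree.specX t (HookTree.P K T) =
      ((HookTree.nodes T).map (HookTree.hookContent t)).prod ∧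
    -- `(q)_n P_T(𝕏) = ∑ (-t)^{m(ε)} q^{maj(σ,ε)}`
    HookTree.qPoch K T.numNodes * HookTree.specX t (HookTree.P K T) =
      HookTree.signedGF (-t) T ∧
    -- the generating function of signed permutations of shape `T`
    HookTree.signedGF t T =
      HookTree.qPoch K T.numNodes * HookTree.specX (-t) (HookTree.P K T) ∧
    HookTree.signedGF t T =
      HookTree.qPoch K T.numNodes *
        ((HookTree.nodes T).map (HookTree.hookContent (-t))).prod ∧
    -- the factor of a node is the contribution of its label among the signed permutations
    ∀ u : ℕ → K,
      HookTree.signedGFLabels (fun j => -u j) T =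
        HookTree.qPoch K T.numNodes *
          ((HookTree.nodes T).map fun s => HookTree.hookContent (u s.label) s).prod := by
  have hGF : ∀ t : K, HookTree.signedGF (-t) T = HookTree.qPoch K T.numNodes *
      ((HookTree.nodes T).map (HookTree.hookContent t)).prod := fun t => by
    rw [HookTree.signedGF_eq_signedGFLabels]
    exact HookTree.signedGFLabels_eq (fun _ => t) T
  refine ⟨?_, HookTree.qPoch_mul_specX_P t T, ?_, ?_, fun u => HookTree.signedGFLabels_eq u T⟩
  -- Both sides agree after multiplication by `(q)_n`, which can be cancelled since its factors have
  -- constant term `1`.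
  · refine mul_left_cancel₀ (HookTree.qPoch_ne_zero K T.numNodes) ?_
    rw [HookTree.qPoch_mul_specX_P, hGF]
  · rw [HookTree.qPoch_mul_specX_P, neg_neg]
  · rw [← hGF, neg_neg]
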